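/- Let $G$ be a finite simple connected bipartite planar graph with at least two vertices and maximum degree at most $3$, and let $X$, $Y$ be the two parts of its bipartition. Let $G^{[\sharp 2]}$ be the exact square of $G$, that is, the graph on $V(G)$ in which two vertices are adjacent if and only if their distance in $G$ is exactly $2$. Then $G^{[\sharp 2]}$ has exactly two connected components, one with vertex set $X$ and the other with vertex set $Y$, and both components are planar. Moreover, if $G$ is outerplanar (it can be drawn in the plane without crossings so that every vertex lies on the boundary of the outer face), then both components are outerplanar. -/

import Mathlib

/-- The Euclidean plane. -/
abbrev Plane : Type := EuclideanSpace ℝ (Fin 2)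

/-- `S` is a polygonal arc with ends `p` and `q`: the union of the segments
`[x 0, x 1], …, [x (n-1), x n]` of a simple (not self-intersecting) polygonal chain
with `x 0 = p` and `x n = q`. -/
def IsPolygonalArc (S : Set Plane) (p q : Plane) : Prop :=
  ∃ (n : ℕ) (x : ℕ → Plane), 0 < n ∧ x 0 = p ∧ x n = q ∧
    S = ⋃ i ∈ Set.Iio n, segment ℝ (x i) (x (i + 1)) ∧
    (∀ i < n, x i ≠ x (i + 1)) ∧
    (∀ i, i + 1 < n →
      segment ℝ (x i) (x (i + 1)) ∩ segment ℝ (x (i + 1)) (x (i + 2)) = {x (i + 1)}) ∧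
    (∀ i j, i + 1 < j → j < n →
      Disjoint (segment ℝ (x i) (x (i + 1))) (segment ℝ (x j) (x (j + 1))))

namespace SimpleGraph

/-- A drawing of `G` in the plane without crossings (a plane graph, with edges drawn as polygonal
arcs): vertices are distinct points, every edge is an arc between its two ends, no edge passes
through a vertex other than its ends, and two different edges meet at most in common ends. -/
structure PlaneDrawing {V : Type*} (G : SimpleGraph V) where
  /-- the point that represents a vertex -/
  pos : V → Plane
  /-- the arc that represents an edge (only the values at edges of `G` matter) -/
  arc : Sym2 V → Set Plane
  pos_injective : Function.Injective pos
  isPolygonalArc : ∀ u v, G.Adj u v → IsPolygonalArc (arc s(u, v)) (pos u) (pos v)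
  vertex_on_arc : ∀ e ∈ G.edgeSet, ∀ w, pos w ∈ arc e → w ∈ e
  arc_inter_arc : ∀ e ∈ G.edgeSet, ∀ f ∈ G.edgeSet, e ≠ f →
    arc e ∩ arc f ⊆ pos '' {w | w ∈ e ∧ w ∈ f}

namespace PlaneDrawing

variable {V : Type*} {G : SimpleGraph V}

/-- The set of all points of the drawing. -/
def carrier (D : G.PlaneDrawing) : Set Plane :=
  Set.range D.pos ∪ ⋃ e ∈ G.edgeSet, D.arc e

/-- The outer face: the unbounded connected component of the complement of the drawing. -/
def outerFace (D : G.PlaneDrawing) : Set Plane :=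
  {x | x ∈ D.carrierᶜ ∧ ¬ Bornology.IsBounded (connectedComponentIn D.carrierᶜ x)}

end PlaneDrawing

/-- `G` can be drawn in the plane without crossings. -/
def IsPlanar {V : Type*} (G : SimpleGraph V) : Prop :=
  Nonempty G.PlaneDrawing

/-- `G` can be drawn in the plane without crossings so that every vertex lies on the boundary of
the outer face. -/
def IsOuterplanar {V : Type*} (G : SimpleGraph V) : Prop :=
  ∃ D : G.PlaneDrawing, ∀ v, D.pos v ∈ frontier D.outerFace

/-- Every vertex has degree at most `3`. -/
def IsSubcubic {V : Type*} (G : SimpleGraph V) : Prop :=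
  ∀ v, (G.neighborSet v).encard ≤ 3

/-- The exact square of `G`: same vertices, adjacent when at distance exactly `2` in `G`. -/
def exactSquare {V : Type*} (G : SimpleGraph V) : SimpleGraph V where
  Adj u v := G.dist u v = 2
  symm := ⟨fun u v h => by rw [G.dist_comm]; exact h⟩
  loopless := ⟨fun v h => by simp at h⟩

end SimpleGraph

/-!
Fix one side `X` of the bipartition and a drawing of `G`. A vertex `y` on the other side has at
most three neighbours, so any two arcs at `y` are consecutive in the cyclic order around `y`, and
their other ends lie on the boundary of a common face. An arc through this face joins them. It
misses `y`, so the arcs at `y` stay as they were, and the step can be repeated: in a maximal plane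
graph obtained in this way, any two vertices of `X` with a common neighbour are adjacent. This
graph contains the component of the exact square with vertex set `X`.

If every vertex lies on the boundary of the outer face, join the vertices in `X` to infinity by
arcs that avoid the drawing. Near `y` these arcs do not interfere, so the new edges can be drawn
without crossing them, and then every vertex of `X` remains on the boundary of the outer face.
-/

open Set Filter Topology

/-! ### Segments and connectivity in normed spaces -/

theorem subset_connectedComponentIn_of_mem {α : Type*} [TopologicalSpace α] {S F : Set α} {x y : α}
    (hS : IsPreconnected S) (hSF : S ⊆ F) (hyS : y ∈ S) (hy : y ∈ connectedComponentIn F x) :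
    S ⊆ connectedComponentIn F x := by
  rw [connectedComponentIn_eq hy]
  exact hS.subset_connectedComponentIn hyS hSF

theorem union_eventuallyEq_left_of_notMem {α : Type*} [TopologicalSpace α] {S T : Set α} {x : α}
    (hT : IsClosed T) (hx : x ∉ T) : (S ∪ T : Set α) =ᶠ[𝓝 x] S := by
  rw [eventuallyEq_set]
  filter_upwards [hT.isOpen_compl.mem_nhds hx] with y hy
  exact or_iff_left hy

theorem biUnion_eventuallyEq_biUnion_mem {α ι : Type*} [TopologicalSpace α] {I : Set ι}
    (hI : I.Finite) {A : ι → Set α} (hA : ∀ i ∈ I, IsClosed (A i)) (x : α) :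
    ⋃ i ∈ I, A i =ᶠ[𝓝 x] ⋃ i ∈ {i ∈ I | x ∈ A i}, A i := by
  have hsplit : I = {i ∈ I | x ∈ A i} ∪ {i ∈ I | x ∉ A i} := by
    rw [← sep_or]; exact (sep_eq_self_iff_mem_true.mpr fun i _ => em _).symm
  conv_lhs => rw [hsplit, biUnion_union]
  refine union_eventuallyEq_left_of_notMem
    ((hI.sep _).isClosed_biUnion fun i hi => hA i hi.1) fun hx => ?_
  obtain ⟨i, hi, hxi⟩ := mem_iUnion₂.mp hx
  exact hi.2 hxi

section NormedSpace

variable {E : Type*} [NormedAddCommGroup E] [NormedSpace ℝ E]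

theorem isCompact_segment (a b : E) : IsCompact (segment ℝ a b) := by
  rw [segment_eq_image_lineMap]
  exact isCompact_Icc.image AffineMap.lineMap_continuous

theorem segment_eq_insert_lineMap_image (a b : E) :
    segment ℝ a b = insert a (AffineMap.lineMap a b '' Ioc (0 : ℝ) 1) := by
  rw [segment_eq_image_lineMap, ← Ioc_insert_left zero_le_one, image_insert_eq,
    AffineMap.lineMap_apply_zero]

theorem segment_union_segment_of_mem {a b z : E} (hz : z ∈ segment ℝ a b) :
    segment ℝ z a ∪ segment ℝ z b = segment ℝ a b := by
  have lineMap_image_Icc {u v : ℝ} (huv : u ≤ v) :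
      AffineMap.lineMap a b '' Icc u v =
        segment ℝ (AffineMap.lineMap a b u : E) (AffineMap.lineMap a b v) := by
    rw [← segment_eq_Icc huv, image_segment]
  rw [segment_eq_image_lineMap] at hz
  obtain ⟨t, ht, rfl⟩ := hz
  have hleft := lineMap_image_Icc ht.1
  have hright := lineMap_image_Icc ht.2
  rw [AffineMap.lineMap_apply_zero] at hleft
  rw [AffineMap.lineMap_apply_one] at hright
  rw [segment_symm, ← hleft, ← hright, ← image_union, Icc_union_Icc_eq_Icc ht.1 ht.2,
    segment_eq_image_lineMap]

theorem openSegment_subset_segment_sdiff {a b : E} (hab : a ≠ b) :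
    openSegment ℝ a b ⊆ segment ℝ a b \ {a, b} := by
  refine fun z hz => ⟨openSegment_subset_segment ℝ a b hz, ?_⟩
  rintro (rfl | rfl)
  exacts [hab (left_mem_openSegment_iff.mp hz), hab (right_mem_openSegment_iff.mp hz)]

theorem segment_subset_closure_sdiff {a b : E} (hab : a ≠ b) :
    segment ℝ a b ⊆ closure (segment ℝ a b \ {a, b}) := by
  rw [← closure_openSegment (𝕜 := ℝ) a b]
  refine closure_mono ?_
  rw [closure_openSegment]
  exact openSegment_subset_segment_sdiff hab

theorem isPreconnected_segment_sdiff {a b : E} {T : Set E} (hab : a ≠ b)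
    (hT : segment ℝ a b ∩ T ⊆ {a, b}) : IsPreconnected (segment ℝ a b \ T) := by
  refine (convex_openSegment a b).isPreconnected.subset_closure (fun z hz => ?_) ?_
  · have hz' := openSegment_subset_segment_sdiff hab hz
    exact ⟨hz'.1, fun hzT => hz'.2 (hT ⟨hz'.1, hzT⟩)⟩
  · rw [closure_openSegment]
    exact sdiff_subset

theorem reflTransGen_segment_subset {F : Set E} (hF : IsOpen F) (hFc : IsPreconnected F) {p q : E}
    (hp : p ∈ F) (hq : q ∈ F) : Relation.ReflTransGen (fun a b => segment ℝ a b ⊆ F) p q := by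
  have : Std.Symm fun a b : E => segment ℝ a b ⊆ F := ⟨fun a b h => segment_symm ℝ a b ▸ h⟩
  refine hFc.induction₂ (Relation.ReflTransGen _) (fun a ha => ?_) (fun _ _ _ _ _ _ => .trans)
    (fun _ _ _ _ => Std.Symm.symm _ _) hp hq
  obtain ⟨r, hr, hball⟩ := Metric.isOpen_iff.mp hF a ha
  filter_upwards [mem_nhdsWithin_of_mem_nhds (Metric.ball_mem_nhds a hr)] with b hb
  exact .single (((convex_ball a r).segment_subset (Metric.mem_ball_self hr) hb).trans hball)

theorem isPreconnected_compl_ball (h : 1 < Module.rank ℝ E) (x : E) (r : ℝ) :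
    IsPreconnected (Metric.ball x r)ᶜ := by
  rcases le_or_gt r 0 with hr | hr
  · rw [Metric.ball_eq_empty.mpr hr, compl_empty]
    exact isPreconnected_univ
  suffices (Metric.ball x r)ᶜ = (fun c : ℝ × E => x + c.1 • c.2) '' Ici r ×ˢ Metric.sphere 0 1 by
    rw [this]
    exact (isPreconnected_Ici.prod (isPreconnected_sphere h 0 1)).image _
      (by fun_prop : Continuous _).continuousOn
  ext y
  rw [mem_compl_iff, mem_ball_iff_norm, not_lt]
  constructor
  · intro hy
    have hne : ‖y - x‖ ≠ 0 := (hr.trans_le hy).ne'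
    refine ⟨(‖y - x‖, ‖y - x‖⁻¹ • (y - x)), ⟨hy, ?_⟩, ?_⟩
    · rw [mem_sphere_zero_iff_norm, norm_smul, norm_inv, norm_norm, inv_mul_cancel₀ hne]
    · simp only [smul_inv_smul₀ hne, add_sub_cancel]
  · rintro ⟨⟨ρ, u⟩, ⟨hρ, hu⟩, rfl⟩
    rw [mem_sphere_zero_iff_norm] at hu
    rw [add_sub_cancel_left, norm_smul, hu, mul_one]
    exact le_trans hρ (Real.le_norm_self ρ)

/-- Near `p`, the set `C` is closed under moving away from `p` along rays. Finite unions of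
segments have this property at every point, and it makes each point in the closure of a component
of the complement of `C` the end of a segment through that component. -/
def RadialAt (C : Set E) (p : E) : Prop :=
  ∀ᶠ q in 𝓝 p, ∀ t ∈ Ioc (0 : ℝ) 1, AffineMap.lineMap p q t ∈ C → q ∈ C

namespace RadialAt

variable {C D : Set E} {p : E}

theorem of_notMem (hC : IsClosed C) (hp : p ∉ C) : RadialAt C p := by
  obtain ⟨r, hr, hball⟩ := Metric.isOpen_iff.mp hC.isOpen_compl p hp
  filter_upwards [Metric.ball_mem_nhds p hr] with q hq t ht hmem
  refine absurd hmem (hball ?_)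
  exact (convex_ball p r).lineMap_mem (Metric.mem_ball_self hr) hq (Ioc_subset_Icc_self ht)

theorem union (hC : RadialAt C p) (hD : RadialAt D p) : RadialAt (C ∪ D) p := by
  filter_upwards [hC, hD] with q hqC hqD t ht
  exact Or.imp (hqC t ht) (hqD t ht)

theorem biUnion {ι : Type*} {I : Set ι} (hI : I.Finite) {C : ι → Set E}
    (h : ∀ i ∈ I, RadialAt (C i) p) : RadialAt (⋃ i ∈ I, C i) p := by
  filter_upwards [(eventually_all_finite hI).mpr h] with q hq t ht hmem
  simp only [mem_iUnion₂] at hmem ⊢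
  obtain ⟨i, hi, hmem⟩ := hmem
  exact ⟨i, hi, hq i hi t ht hmem⟩

theorem segment_left (p s : E) : RadialAt (segment ℝ p s) p := by
  obtain rfl | hs := eq_or_ne s p
  · refine Eventually.of_forall fun q t ht hmem => ?_
    rw [segment_same, mem_singleton_iff, AffineMap.lineMap_eq_left_iff] at hmem
    rw [segment_same, mem_singleton_iff, hmem.resolve_right ht.1.ne']
  · filter_upwards [Metric.ball_mem_nhds p (dist_pos.mpr hs)] with q hq t ht hmem
    rw [segment_eq_image'] at hmem ⊢
    obtain ⟨l, hl, hlt⟩ := hmem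
    have hsmul : l • (s - p) = t • (q - p) :=
      add_left_cancel (hlt.trans (by rw [AffineMap.lineMap_apply_module', add_comm]))
    have hsub : q - p = (l / t) • (s - p) := by
      rw [div_eq_inv_mul, mul_smul, hsmul, inv_smul_smul₀ ht.1.ne']
    have hnonneg : 0 ≤ l / t := div_nonneg hl.1 ht.1.le
    have hdist : l / t * dist s p < dist s p := by
      rwa [Metric.mem_ball, dist_eq_norm, hsub, norm_smul, Real.norm_of_nonneg hnonneg,
        ← dist_eq_norm] at hq
    refine ⟨l / t, ⟨hnonneg, ?_⟩, by simp only [← hsub, add_sub_cancel]⟩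
    exact ((mul_lt_iff_lt_one_left (dist_pos.mpr hs)).mp hdist).le

theorem segment (a b p : E) : RadialAt (segment ℝ a b) p := by
  by_cases hp : p ∈ _root_.segment ℝ a b
  · rw [← segment_union_segment_of_mem hp]
    exact (segment_left p a).union (segment_left p b)
  · exact of_notMem (isCompact_segment a b).isClosed hp

theorem exists_segment_subset_insert {x : E} (hC : RadialAt C p)
    (hp : p ∈ closure (connectedComponentIn Cᶜ x)) :
    ∃ q ∈ connectedComponentIn Cᶜ x,
      _root_.segment ℝ p q ⊆ insert p (connectedComponentIn Cᶜ x) := by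
  obtain ⟨q, hq, hqx⟩ := mem_closure_iff_nhds.mp hp _ hC
  refine ⟨q, hqx, ?_⟩
  rw [segment_eq_insert_lineMap_image]
  refine insert_subset_insert (subset_connectedComponentIn_of_mem
    (isPreconnected_Ioc.image _ AffineMap.lineMap_continuous.continuousOn) ?_
    ⟨1, ⟨one_pos, le_rfl⟩, AffineMap.lineMap_apply_one _ _⟩ hqx)
  rintro _ ⟨t, ht, rfl⟩ hmem
  exact connectedComponentIn_subset _ _ hqx (hq t ht hmem)

end RadialAt

end NormedSpace

/-! ### Polar coordinates and germs of rays -/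

theorem coe_angle_injOn_Ioc (a : ℝ) :
    InjOn ((↑) : ℝ → Real.Angle) (Ioc a (a + 2 * Real.pi)) := fun _ hx _ hy h =>
  (AddCircle.coe_eq_coe_iff_of_mem_Ioc (hp := ⟨Real.two_pi_pos⟩) hx hy).mp h

theorem coe_angle_image_Ioc (a : ℝ) :
    ((↑) : ℝ → Real.Angle) '' Ioc a (a + 2 * Real.pi) = univ :=
  AddCircle.coe_image_Ioc_eq _ (hp := ⟨Real.two_pi_pos⟩) a

theorem coe_angle_add_two_pi (t : ℝ) : ((t + 2 * Real.pi : ℝ) : Real.Angle) = t := by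
  rw [Real.Angle.coe_add, Real.Angle.coe_two_pi, add_zero]

theorem exists_angle_lifts (θ₁ θ₂ : Real.Angle) :
    ∃ t₁ : ℝ, ∃ t₂ ∈ Ioc t₁ (t₁ + 2 * Real.pi),
      (t₁ : Real.Angle) = θ₁ ∧ (t₂ : Real.Angle) = θ₂ := by
  obtain ⟨t₁, rfl⟩ : ∃ t₁ : ℝ, (t₁ : Real.Angle) = θ₁ := θ₁.induction_on fun x => ⟨x, rfl⟩
  obtain ⟨t₂, ht₂, rfl⟩ := (coe_angle_image_Ioc t₁).ge (mem_univ θ₂)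
  exact ⟨t₁, t₂, ht₂, rfl, rfl⟩

section AngleGaps

variable {t₁ t₂ : ℝ} (ht : t₂ ∈ Ioc t₁ (t₁ + 2 * Real.pi))
include ht

theorem coe_angle_image_Ioo_union_Ioo :
    ((↑) : ℝ → Real.Angle) '' Ioo t₁ t₂ ∪ (↑) '' Ioo t₂ (t₁ + 2 * Real.pi) =
      {(t₁ : Real.Angle), (t₂ : Real.Angle)}ᶜ := by
  have hends : {t₂, t₁ + 2 * Real.pi} ⊆ Ioc t₁ (t₁ + 2 * Real.pi) :=
    pair_subset ht ⟨ht.1.trans_le ht.2, le_rfl⟩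
  have hgaps : Ioo t₁ t₂ ∪ Ioo t₂ (t₁ + 2 * Real.pi) =
      Ioc t₁ (t₁ + 2 * Real.pi) \ {t₂, t₁ + 2 * Real.pi} := by
    rw [← Ioc_union_Ioc_eq_Ioc ht.1.le ht.2]
    grind
  rw [← image_union, hgaps, (coe_angle_injOn_Ioc t₁).image_sdiff_subset hends,
    coe_angle_image_Ioc, image_pair, coe_angle_add_two_pi, pair_comm, compl_eq_univ_sdiff]

theorem disjoint_coe_angle_image_Ioo :
    Disjoint (((↑) : ℝ → Real.Angle) '' Ioo t₁ t₂) ((↑) '' Ioo t₂ (t₁ + 2 * Real.pi)) := by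
  rw [disjoint_iff_inter_eq_empty, ← (coe_angle_injOn_Ioc t₁).image_inter, Ioo_inter_Ioo,
    Ioo_eq_empty (by simp), image_empty]
  · exact Ioo_subset_Ioc_self.trans (Ioc_subset_Ioc_right ht.2)
  · exact Ioo_subset_Ioc_self.trans (Ioc_subset_Ioc_left ht.1.le)

end AngleGaps

/-- The point with polar coordinates `(ρ, θ)` around `p`. -/
noncomputable def polar (p : Plane) (ρ : ℝ) (θ : Real.Angle) : Plane :=
  p + ρ • !₂[θ.cos, θ.sin]

/-- The union of the closed rays from `p` in the directions `Θ`. The germ at `p` of a polygonal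
arc, or of a drawing, has this form. -/
def spokes (p : Plane) (Θ : Set Real.Angle) : Set Plane :=
  image2 (polar p) (Ici 0) Θ

/-- The open circular sector around `p` of radius `r` between the angles `α` and `β`; these are
real numbers, so that there is an interval between them. -/
def sector (p : Plane) (r α β : ℝ) : Set Plane :=
  image2 (polar p) (Ioo 0 r) ((↑) '' Ioo α β)

section PolarCoordinates

variable {p q : Plane} {ρ r α β : ℝ} {θ : Real.Angle} {Θ : Set Real.Angle}

theorem continuous_polar (p : Plane) : Continuous fun c : ℝ × Real.Angle => polar p c.1 c.2 := by
  have hcos := Real.Angle.continuous_cos.comp (continuous_snd (X := ℝ))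
  have hsin := Real.Angle.continuous_sin.comp (continuous_snd (X := ℝ))
  refine continuous_const.add (continuous_fst.smul ?_)
  exact (PiLp.continuous_toLp 2 _).comp
    (continuous_pi (Fin.forall_fin_two.mpr ⟨hcos, hsin⟩))

theorem dist_polar (p : Plane) (hρ : 0 ≤ ρ) (θ : Real.Angle) : dist (polar p ρ θ) p = ρ := by
  simp [polar, norm_smul, EuclideanSpace.norm_eq, Real.Angle.cos_sq_add_sin_sq, abs_of_nonneg hρ]

theorem polar_zero (p : Plane) (θ : Real.Angle) : polar p 0 θ = p := by
  rw [polar, zero_smul, add_zero]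

theorem exists_polar_eq (h : q ≠ p) : ∃ ρ > 0, ∃ θ, polar p ρ θ = q := by
  set w : ℂ := ⟨q 0 - p 0, q 1 - p 1⟩
  have hw : w ≠ 0 := fun hw => h <| by
    ext i
    fin_cases i
    · exact sub_eq_zero.mp (congrArg Complex.re hw)
    · exact sub_eq_zero.mp (congrArg Complex.im hw)
  refine ⟨‖w‖, norm_pos_iff.mpr hw, w.arg, ?_⟩
  ext i
  fin_cases i
  · simp [polar, Complex.norm_mul_cos_arg, w]
  · simp [polar, Complex.norm_mul_sin_arg, w]

theorem angle_eq_of_polar_eq {ρ' : ℝ} {θ' : Real.Angle} (hρ : 0 < ρ) (hρ' : 0 ≤ ρ')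
    (h : polar p ρ θ = polar p ρ' θ') : θ = θ' := by
  obtain rfl : ρ = ρ' := by rw [← dist_polar p hρ.le θ, h, dist_polar p hρ']
  have hdir : !₂[θ.cos, θ.sin] = !₂[θ'.cos, θ'.sin] :=
    smul_right_injective _ hρ.ne' (add_left_cancel h)
  have hcos : θ.cos = θ'.cos := congrArg (fun v : Plane => v 0) hdir
  have hsin : θ.sin = θ'.sin := congrArg (fun v : Plane => v 1) hdir
  induction θ using Real.Angle.induction_on
  induction θ' using Real.Angle.induction_on
  exact Real.Angle.cos_sin_inj hcos hsin

theorem polar_mem_spokes (hρ : 0 < ρ) : polar p ρ θ ∈ spokes p Θ ↔ θ ∈ Θ := by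
  refine ⟨?_, fun hθ => mem_image2_of_mem hρ.le hθ⟩
  rintro ⟨ρ', hρ', θ', hθ', h⟩
  rwa [angle_eq_of_polar_eq hρ hρ' h.symm]

theorem mem_spokes_self (hΘ : Θ.Nonempty) : p ∈ spokes p Θ :=
  let ⟨θ, hθ⟩ := hΘ
  ⟨0, self_mem_Ici, θ, hθ, polar_zero p θ⟩

theorem disjoint_of_spokes_inter_spokes_eventuallyLE {Θ' : Set Real.Angle}
    (h : (spokes p Θ ∩ spokes p Θ' : Set Plane) ≤ᶠ[𝓝 p] ({p} : Set Plane)) : Disjoint Θ Θ' := by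
  refine disjoint_left.mpr fun θ hθ hθ' => ?_
  obtain ⟨r, hr, hball⟩ := Metric.eventually_nhds_iff.mp h
  have hdist := dist_polar p (half_pos hr).le θ
  have heq : polar p (r / 2) θ = p := hball (hdist.trans_lt (half_lt_self hr))
    ⟨(polar_mem_spokes (half_pos hr)).mpr hθ, (polar_mem_spokes (half_pos hr)).mpr hθ'⟩
  rw [heq, dist_self] at hdist
  exact (half_pos hr).ne hdist

theorem isPreconnected_sector (p : Plane) (r α β : ℝ) : IsPreconnected (sector p r α β) := by
  rw [sector, ← image_uncurry_prod]
  exact (isPreconnected_Ioo.prod (isPreconnected_Ioo.image _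
    Real.Angle.continuous_coe.continuousOn)).image _ (continuous_polar p).continuousOn

theorem spokes_eventuallyLE_closure_sector (hr : 0 < r) (hαβ : α < β) :
    spokes p {(α : Real.Angle), (β : Real.Angle)} ≤ᶠ[𝓝 p] closure (sector p r α β) := by
  filter_upwards [Metric.ball_mem_nhds p hr] with q hq hmem
  obtain ⟨ρ, hρ, θ, hθ, rfl⟩ := hmem
  rw [Metric.mem_ball, dist_polar p hρ] at hq
  have hρ' : ρ ∈ closure (Ioo 0 r) := by
    rw [closure_Ioo hr.ne]
    exact ⟨hρ, hq.le⟩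
  have hθ' : θ ∈ closure (((↑) : ℝ → Real.Angle) '' Ioo α β) := by
    refine image_closure_subset_closure_image Real.Angle.continuous_coe ?_
    rw [closure_Ioo hαβ.ne]
    rcases hθ with rfl | rfl
    · exact mem_image_of_mem _ (left_mem_Icc.mpr hαβ.le)
    · exact mem_image_of_mem _ (right_mem_Icc.mpr hαβ.le)
  exact map_mem_closure₂ (continuous_polar p) hρ' hθ' fun _ ha _ hb => mem_image2_of_mem ha hb

theorem spokes_eventuallyLE_closure_connectedComponentIn {F : Set Plane} {x : Plane}
    (hF : sector p r α β ⊆ F) (hq : q ∈ sector p r α β) (hqx : q ∈ connectedComponentIn F x) :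
    spokes p {(α : Real.Angle), (β : Real.Angle)} ≤ᶠ[𝓝 p]
      closure (connectedComponentIn F x) := by
  have hsub := subset_connectedComponentIn_of_mem (isPreconnected_sector p r α β) hF hq hqx
  obtain ⟨ρ, hρ, _, ⟨t, ht, -⟩, -⟩ := hq
  filter_upwards [spokes_eventuallyLE_closure_sector (hρ.1.trans hρ.2) (ht.1.trans ht.2)]
    with q h hmem
  exact closure_mono hsub (h hmem)

theorem eventually_sector_subset_compl {C : Set Plane} (hC : C ≤ᶠ[𝓝 p] spokes p Θ)
    (hΘ : Disjoint ((↑) '' Ioo α β) Θ) : ∀ᶠ r in 𝓝[>] 0, sector p r α β ⊆ Cᶜ := by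
  obtain ⟨r₀, hr₀, hball⟩ := Metric.eventually_nhds_iff.mp hC
  filter_upwards [Ioo_mem_nhdsGT hr₀] with r hr
  rintro _ ⟨ρ, hρ, θ, hθ, rfl⟩ hmem
  have hdist : dist (polar p ρ θ) p < r₀ := (dist_polar p hρ.1.le θ).trans_lt (hρ.2.trans hr.2)
  exact disjoint_left.mp hΘ hθ ((polar_mem_spokes hρ.1).mp (hball hdist hmem))

theorem spokes_pair_eventuallyLE_closure {C : Set Plane} {x : Plane} {θ₁ θ₂ : Real.Angle}
    (hC : C =ᶠ[𝓝 p] spokes p {θ₁, θ₂}) (hp : p ∈ closure (connectedComponentIn Cᶜ x)) :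
    spokes p {θ₁, θ₂} ≤ᶠ[𝓝 p] closure (connectedComponentIn Cᶜ x) := by
  obtain ⟨t₁, t₂, ht, rfl, rfl⟩ := exists_angle_lifts θ₁ θ₂
  have hgaps := coe_angle_image_Ioo_union_Ioo ht
  have hdisj := (disjoint_compl_left (a := {(t₁ : Real.Angle), (t₂ : Real.Angle)})).mono_left
    hgaps.le
  rw [disjoint_union_left] at hdisj
  obtain ⟨r, ⟨hr₁, hr₂⟩, hr : 0 < r⟩ := ((eventually_sector_subset_compl hC.le hdisj.1).and
    (eventually_sector_subset_compl hC.le hdisj.2)).and self_mem_nhdsWithin |>.exists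
  obtain ⟨q, ⟨hqr, hqC⟩, hqx⟩ :=
    mem_closure_iff_nhds.mp hp _ (inter_mem (Metric.ball_mem_nhds p hr) hC.mem_iff)
  have hq : q ∉ spokes p {(t₁ : Real.Angle), (t₂ : Real.Angle)} := fun h =>
    connectedComponentIn_subset _ _ hqx (hqC.mpr h)
  have hqp : q ≠ p := fun h => hq (h ▸ mem_spokes_self (insert_nonempty _ _))
  obtain ⟨ρ, hρ, θ, rfl⟩ := exists_polar_eq hqp
  rw [Metric.mem_ball, dist_polar p hρ.le] at hqr
  rw [polar_mem_spokes hρ, ← mem_compl_iff, ← hgaps] at hq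
  rcases hq with hθ | hθ
  · exact spokes_eventuallyLE_closure_connectedComponentIn hr₁
      (mem_image2_of_mem ⟨hρ, hqr⟩ hθ) hqx
  · rw [pair_comm, ← coe_angle_add_two_pi t₁]
    exact spokes_eventuallyLE_closure_connectedComponentIn hr₂
      (mem_image2_of_mem ⟨hρ, hqr⟩ hθ) hqx

/-- Besides `θ₁` and `θ₂` there is at most one angle in `Θ`, so it misses one of the two open
sectors between `θ₁` and `θ₂`. -/
theorem exists_spokes_pair_eventuallyLE_closure {C : Set Plane} {θ₁ θ₂ : Real.Angle}
    (hcard : Θ.encard ≤ 3) (hθ₁ : θ₁ ∈ Θ) (hθ₂ : θ₂ ∈ Θ) (hne : θ₁ ≠ θ₂)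
    (hC : C ≤ᶠ[𝓝 p] spokes p Θ) :
    ∃ x, spokes p {θ₁, θ₂} ≤ᶠ[𝓝 p] closure (connectedComponentIn Cᶜ x) := by
  have of_disjoint {α β : ℝ} (hαβ : α < β) (hdisj : Disjoint ((↑) '' Ioo α β) Θ) :
      ∃ x, spokes p {(α : Real.Angle), (β : Real.Angle)} ≤ᶠ[𝓝 p]
        closure (connectedComponentIn Cᶜ x) := by
    obtain ⟨r, hr, hpos : 0 < r⟩ :=
      (eventually_sector_subset_compl hC hdisj).and self_mem_nhdsWithin |>.exists
    obtain ⟨q, hq⟩ : (sector p r α β).Nonempty :=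
      (nonempty_Ioo.mpr hpos).image2 ((nonempty_Ioo.mpr hαβ).image _)
    exact ⟨q, spokes_eventuallyLE_closure_connectedComponentIn hr hq
      (mem_connectedComponentIn (hr hq))⟩
  obtain ⟨t₁, t₂, ht, rfl, rfl⟩ := exists_angle_lifts θ₁ θ₂
  have hlt : t₂ < t₁ + 2 * Real.pi := ht.2.lt_of_ne fun h =>
    hne (by rw [h, coe_angle_add_two_pi])
  have hrest : (Θ \ {(t₁ : Real.Angle), (t₂ : Real.Angle)}).Subsingleton := by
    rw [← encard_le_one_iff_subsingleton]
    have := encard_sdiff_add_encard_of_subset (pair_subset hθ₁ hθ₂)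
    rw [encard_pair hne] at this
    exact (ENat.add_le_add_iff_right (by decide : (2 : ℕ∞) ≠ ⊤)).mp (this.trans_le hcard)
  have hgaps := (coe_angle_image_Ioo_union_Ioo ht).le
  rw [union_subset_iff] at hgaps
  by_cases hdisj : Disjoint ((↑) '' Ioo t₁ t₂) Θ
  · exact of_disjoint ht.1 hdisj
  · obtain ⟨θ, hθ, hθΘ⟩ := not_disjoint_iff.mp hdisj
    rw [pair_comm, ← coe_angle_add_two_pi t₁]
    refine of_disjoint hlt (disjoint_left.mpr fun θ' hθ' hθ'Θ => ?_)
    obtain rfl := hrest ⟨hθΘ, hgaps.1 hθ⟩ ⟨hθ'Θ, hgaps.2 hθ'⟩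
    exact disjoint_left.mp (disjoint_coe_angle_image_Ioo ht) hθ hθ'

theorem exists_segment_eventuallyEq_spokes (h : q ≠ p) :
    ∃ θ, segment ℝ p q =ᶠ[𝓝 p] spokes p {θ} := by
  obtain ⟨R, hR, θ, rfl⟩ := exists_polar_eq h
  refine ⟨θ, ?_⟩
  rw [eventuallyEq_set]
  filter_upwards [Metric.ball_mem_nhds p hR] with x hx
  rw [segment_eq_image', spokes, image2_singleton_right]
  constructor
  · rintro ⟨t, ht, rfl⟩
    exact ⟨t * R, mul_nonneg ht.1 hR.le, by simp only [polar, add_sub_cancel_left, mul_smul]⟩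
  · rintro ⟨ρ, hρ, rfl⟩
    rw [Metric.mem_ball, dist_polar p hρ] at hx
    refine ⟨ρ / R, ⟨div_nonneg hρ hR.le, (div_le_one hR).mpr hx.le⟩, ?_⟩
    simp only [polar, add_sub_cancel_left, smul_smul, div_mul_cancel₀ _ hR.ne']

theorem spokes_union (p : Plane) (Θ Θ' : Set Real.Angle) :
    spokes p (Θ ∪ Θ') = spokes p Θ ∪ spokes p Θ' :=
  image2_union_right

theorem exists_segment_eventuallyEq_spokes_pair {a b : Plane} (hp : p ∈ segment ℝ a b) (ha : p ≠ a)
    (hb : p ≠ b) : ∃ θ₁ θ₂, segment ℝ a b =ᶠ[𝓝 p] spokes p {θ₁, θ₂} := by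
  obtain ⟨θ₁, hθ₁⟩ := exists_segment_eventuallyEq_spokes ha.symm
  obtain ⟨θ₂, hθ₂⟩ := exists_segment_eventuallyEq_spokes hb.symm
  refine ⟨θ₁, θ₂, ?_⟩
  rw [← segment_union_segment_of_mem hp, insert_eq, spokes_union]
  exact hθ₁.union hθ₂

end PolarCoordinates

/-! ### Polygonal arcs -/

theorem isPolygonalArc_segment {p q : Plane} (hpq : p ≠ q) :
    IsPolygonalArc (segment ℝ p q) p q := by
  refine ⟨1, fun i => if i = 0 then p else q, one_pos, rfl, rfl, ?_, ?_, by grind, by grind⟩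
  · simp
  · simpa [Nat.lt_one_iff] using hpq

namespace IsPolygonalArc

variable {S C T : Set Plane} {p q r : Plane}

theorem cons_segment (hS : IsPolygonalArc S q r) (hpq : p ≠ q) (hinter : segment ℝ p q ∩ S ⊆ {q}) :
    IsPolygonalArc (segment ℝ p q ∪ S) p r := by
  obtain ⟨n, x, hn, rfl, rfl, rfl, hne, hnext, hdisj⟩ := hS
  have eq_of_mem {z : Plane} {j : ℕ} (hj : j < n) (hz : z ∈ segment ℝ p (x 0))
      (hzj : z ∈ segment ℝ (x j) (x (j + 1))) : z = x 0 :=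
    hinter ⟨hz, mem_biUnion hj hzj⟩
  let y : ℕ → Plane := fun i => Nat.casesOn i p x
  refine ⟨n + 1, y, n.succ_pos, rfl, rfl,
    (biUnion_lt_succ' (fun i => segment ℝ (y i) (y (i + 1))) n).symm, ?_, ?_, ?_⟩
  · rintro (_ | i) hi
    exacts [hpq, hne i (Nat.lt_of_succ_lt_succ hi)]
  · rintro (_ | i) hi
    · exact Subset.antisymm (fun z hz => eq_of_mem hn hz.1 hz.2)
        (singleton_subset_iff.mpr ⟨right_mem_segment _ _ _, left_mem_segment _ _ _⟩)
    · exact hnext i (Nat.lt_of_succ_lt_succ hi)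
  · rintro (_ | i) (_ | _ | j) hij hj
    · omega
    · omega
    · refine disjoint_left.mpr fun z hz hzj => ?_
      obtain rfl := eq_of_mem (by omega) hz hzj
      obtain rfl | hj0 := j.eq_zero_or_pos
      · exact hne 0 hn ((hnext 0 (by omega)).le ⟨left_mem_segment _ _ _, hzj⟩)
      · exact disjoint_left.mp (hdisj 0 (j + 1) (by omega) (by omega))
          (left_mem_segment _ _ _) hzj
    · omega
    · omega
    · exact hdisj i (j + 1) (by omega) (by omega)

@[elab_as_elim]
theorem induction {motive : ∀ (S : Set Plane) (p : Plane), IsPolygonalArc S p r → Prop}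
    (segment : ∀ p (hpr : p ≠ r), motive (segment ℝ p r) p (isPolygonalArc_segment hpr))
    (cons : ∀ S p q (hS : IsPolygonalArc S q r) (hpq : p ≠ q)
      (hinter : _root_.segment ℝ p q ∩ S ⊆ {q}), motive S q hS →
      motive (_root_.segment ℝ p q ∪ S) p (hS.cons_segment hpq hinter))
    (hS : IsPolygonalArc S p r) : motive S p hS := by
  obtain ⟨n, x, hn, rfl, hr, hSx, hne, hnext, hdisj⟩ := id hS
  induction n generalizing S x with
  | zero => exact absurd hn (lt_irrefl 0)
  | succ n ih =>
    replace hSx := hSx.trans (biUnion_lt_succ' _ n)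
    obtain rfl | hn0 := n.eq_zero_or_pos
    · simp only [not_lt_zero, iUnion_of_empty, iUnion_empty, union_empty] at hSx
      subst hSx hr
      exact segment _ (hne 0 one_pos)
    subst hSx
    have hrest : IsPolygonalArc _ (x 1) r :=
      ⟨n, fun i => x (i + 1), hn0, rfl, hr, rfl, fun i hi => hne _ (by omega),
        fun i hi => hnext _ (by omega), fun i j hij hj => hdisj _ _ (by omega) (by omega)⟩
    refine cons _ _ _ hrest (hne 0 (by omega)) ?_ ?_
    · rintro z ⟨hz, hzS⟩
      obtain ⟨_ | i, hi, hzi⟩ := mem_iUnion₂.mp hzS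
      · exact (hnext 0 (by omega)).le ⟨hz, hzi⟩
      · exact absurd hzi (disjoint_left.mp
          (hdisj 0 (i + 2) (by omega) (Nat.succ_lt_succ hi)) hz)
    · exact ih (fun i => x (i + 1)) hn0 hrest hr rfl (fun i hi => hne _ (by omega))
        (fun i hi => hnext _ (by omega)) fun i j hij hj => hdisj _ _ (by omega) (by omega)

theorem isCompact (hS : IsPolygonalArc S p r) : IsCompact S := by
  induction hS using IsPolygonalArc.induction with
  | segment p _ => exact isCompact_segment p r
  | cons S p q _ _ _ hS => exact (isCompact_segment p q).union hS

theorem isClosed (hS : IsPolygonalArc S p r) : IsClosed S := hS.isCompact.isClosed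

theorem radialAt (hS : IsPolygonalArc S p r) (z : Plane) : RadialAt S z := by
  induction hS using IsPolygonalArc.induction with
  | segment p _ => exact .segment p r z
  | cons S p q _ _ _ hS => exact (RadialAt.segment p q z).union hS

theorem left_mem (hS : IsPolygonalArc S p r) : p ∈ S := by
  induction hS using IsPolygonalArc.induction with
  | segment p _ => exact left_mem_segment ℝ p r
  | cons S p q => exact Or.inl (left_mem_segment ℝ p q)

theorem right_mem (hS : IsPolygonalArc S p r) : r ∈ S := by
  induction hS using IsPolygonalArc.induction with
  | segment p _ => exact right_mem_segment ℝ p r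
  | cons S p q _ _ _ hr => exact Or.inr hr

theorem ne (hS : IsPolygonalArc S p r) : p ≠ r := by
  induction hS using IsPolygonalArc.induction with
  | segment _ hpr => exact hpr
  | cons S p q hS hpq hinter =>
    rintro rfl
    exact hpq (hinter ⟨left_mem_segment ℝ p q, hS.right_mem⟩)

theorem append_segment {v : Plane} (hS : IsPolygonalArc S p r) (hrv : r ≠ v)
    (hinter : S ∩ segment ℝ r v ⊆ {r}) : IsPolygonalArc (S ∪ segment ℝ r v) p v := by
  induction hS using IsPolygonalArc.induction with
  | segment _ hpr => exact (isPolygonalArc_segment hrv).cons_segment hpr hinter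
  | cons S p q hS hpq hpqS ih =>
    rw [union_inter_distrib_right, union_subset_iff] at hinter
    rw [union_assoc]
    refine (ih hinter.2).cons_segment hpq ?_
    rw [inter_union_distrib_left]
    refine union_subset hpqS fun z hz => ?_
    obtain rfl := hinter.1 hz
    exact hpqS ⟨hz.1, hS.right_mem⟩

theorem symm (hS : IsPolygonalArc S p r) : IsPolygonalArc S r p := by
  induction hS using IsPolygonalArc.induction with
  | segment p hpr =>
    rw [segment_symm]
    exact isPolygonalArc_segment hpr.symm
  | cons S p q hS hpq hinter ih =>
    rw [union_comm, segment_symm]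
    rw [inter_comm, segment_symm] at hinter
    exact ih.append_segment hpq.symm hinter

theorem exists_eventuallyEq_spokes (hS : IsPolygonalArc S p r) :
    ∃ θ, S =ᶠ[𝓝 p] spokes p {θ} := by
  induction hS using IsPolygonalArc.induction with
  | segment p hpr => exact exists_segment_eventuallyEq_spokes hpr.symm
  | cons S p q hS hpq hinter =>
    obtain ⟨θ, hθ⟩ := exists_segment_eventuallyEq_spokes hpq.symm
    have hpS : p ∉ S := fun hp => hpq (hinter ⟨left_mem_segment ℝ p q, hp⟩)
    exact ⟨θ, (union_eventuallyEq_left_of_notMem hS.isClosed hpS).trans hθ⟩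

theorem exists_eventuallyEq_spokes_pair {z : Plane} (hS : IsPolygonalArc S p r) (hz : z ∈ S)
    (hzp : z ≠ p) (hzr : z ≠ r) : ∃ θ₁ θ₂, S =ᶠ[𝓝 z] spokes z {θ₁, θ₂} := by
  induction hS using IsPolygonalArc.induction with
  | segment p _ => exact exists_segment_eventuallyEq_spokes_pair hz hzp hzr
  | cons S p q hS hpq hinter ih =>
    obtain rfl | hzq := eq_or_ne z q
    · obtain ⟨θ₁, hθ₁⟩ := exists_segment_eventuallyEq_spokes hzp.symm
      obtain ⟨θ₂, hθ₂⟩ := hS.exists_eventuallyEq_spokes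
      refine ⟨θ₁, θ₂, ?_⟩
      rw [segment_symm, insert_eq, spokes_union]
      exact hθ₁.union hθ₂
    · rcases hz with hz | hz
      · obtain ⟨θ₁, θ₂, hθ⟩ := exists_segment_eventuallyEq_spokes_pair hz hzp hzq
        have hzS : z ∉ S := fun hzS => hzq (hinter ⟨hz, hzS⟩)
        exact ⟨θ₁, θ₂, (union_eventuallyEq_left_of_notMem hS.isClosed hzS).trans hθ⟩
      · obtain ⟨θ₁, θ₂, hθ⟩ := ih hz hzq
        have hzpq : z ∉ _root_.segment ℝ p q := fun hzpq => hzq (hinter ⟨hzpq, hz⟩)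
        rw [union_comm]
        exact ⟨θ₁, θ₂, (union_eventuallyEq_left_of_notMem
          (isCompact_segment p q).isClosed hzpq).trans hθ⟩

theorem isPreconnected_sdiff (hS : IsPolygonalArc S p r) (hT : S ∩ T ⊆ {p, r}) :
    IsPreconnected (S \ T) := by
  induction hS using IsPolygonalArc.induction with
  | segment p hpr => exact isPreconnected_segment_sdiff hpr hT
  | cons S p q hS hpq hinter ih =>
    have hpS : p ∉ S := fun hp => hpq (hinter ⟨left_mem_segment ℝ p q, hp⟩)
    have hrpq : r ∉ _root_.segment ℝ p q := fun hr => hS.ne (hinter ⟨hr, hS.right_mem⟩).symm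
    have hqT : q ∉ T := fun hq => (hT ⟨Or.inr hS.left_mem, hq⟩).elim hpq.symm hS.ne
    rw [union_sdiff_distrib]
    refine (isPreconnected_segment_sdiff hpq fun z hz => Or.inl ?_).union q
      ⟨right_mem_segment ℝ p q, hqT⟩ ⟨hS.left_mem, hqT⟩ (ih fun z hz => Or.inr ?_)
    · exact (hT ⟨Or.inl hz.1, hz.2⟩).resolve_right fun h => hrpq (h ▸ hz.1)
    · exact (hT ⟨Or.inr hz.1, hz.2⟩).resolve_left fun h => hpS (h ▸ hz.1)

theorem subset_closure_sdiff (hS : IsPolygonalArc S p r) : S ⊆ closure (S \ {p, r}) := by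
  induction hS using IsPolygonalArc.induction with
  | segment p hpr => exact segment_subset_closure_sdiff hpr
  | cons S p q hS hpq hinter ih =>
    have hpS : p ∉ S := fun hp => hpq (hinter ⟨left_mem_segment ℝ p q, hp⟩)
    have hrpq : r ∉ _root_.segment ℝ p q := fun hr => hS.ne (hinter ⟨hr, hS.right_mem⟩).symm
    refine union_subset ((segment_subset_closure_sdiff hpq).trans (closure_mono ?_))
      (ih.trans (closure_mono ?_))
    · rintro z ⟨hz, hzpq⟩
      exact ⟨Or.inl hz, not_or.mpr ⟨fun h => hzpq (Or.inl h), fun h => hrpq (h ▸ hz)⟩⟩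
    · rintro z ⟨hz, hzqr⟩
      exact ⟨Or.inr hz, not_or.mpr ⟨fun h => hpS (h ▸ hz), fun h => hzqr (Or.inr h)⟩⟩

theorem subset_closure_connectedComponentIn {x : Plane} (hS : IsPolygonalArc S p r)
    (hC : ∀ z ∈ S \ {p, r}, C =ᶠ[𝓝 z] S)
    (hne : ((S \ {p, r}) ∩ closure (connectedComponentIn Cᶜ x)).Nonempty) :
    S ⊆ closure (connectedComponentIn Cᶜ x) := by
  set F := closure (connectedComponentIn Cᶜ x)
  have eventually_mem {z : Plane} (hz : z ∈ S \ {p, r}) (hzF : z ∈ F) : S ≤ᶠ[𝓝 z] F := by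
    have hzpr := not_or.mp hz.2
    obtain ⟨θ₁, θ₂, hθ⟩ := hS.exists_eventuallyEq_spokes_pair hz.1 hzpr.1 hzpr.2
    exact hθ.le.trans (spokes_pair_eventuallyLE_closure ((hC z hz).trans hθ) hzF)
  obtain ⟨w, hw, hwF⟩ := hne
  refine hS.subset_closure_sdiff.trans (closure_minimal (fun z hz => ?_) isClosed_closure)
  refine ((hS.isPreconnected_sdiff inter_subset_right).induction₂ (fun a b => a ∈ F ↔ b ∈ F)
    (fun a ha => ?_) (fun _ _ _ _ _ _ => Iff.trans) (fun _ _ _ _ => Iff.symm) hw hz).mp hwF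
  by_cases haF : a ∈ F
  · filter_upwards [mem_nhdsWithin_of_mem_nhds (eventually_mem ha haF), self_mem_nhdsWithin]
      with b hb hbS
    exact iff_of_true haF (hb hbS.1)
  · filter_upwards [mem_nhdsWithin_of_mem_nhds (isClosed_closure.isOpen_compl.mem_nhds haF)]
      with b hb
    exact iff_of_false haF hb

theorem exists_truncate {z : Plane} (hS : IsPolygonalArc S p r) (hz : z ∈ S) (hzr : z ≠ r) :
    ∃ B ⊆ S, IsPolygonalArc B z r := by
  induction hS using IsPolygonalArc.induction with
  | segment p _ =>
    exact ⟨_, (convex_segment p r).segment_subset hz (right_mem_segment ℝ p r),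
      isPolygonalArc_segment hzr⟩
  | cons S p q hS _ hinter ih =>
    by_cases hzS : z ∈ S
    · obtain ⟨B, hBS, hB⟩ := ih hzS
      exact ⟨B, hBS.trans subset_union_right, hB⟩
    · have hzq : z ≠ q := fun h => hzS (h ▸ hS.left_mem)
      have hsub : _root_.segment ℝ z q ⊆ _root_.segment ℝ p q :=
        (convex_segment p q).segment_subset (hz.resolve_right hzS) (right_mem_segment ℝ p q)
      exact ⟨_, union_subset_union_left S hsub,
        hS.cons_segment hzq ((inter_subset_inter_left S hsub).trans hinter)⟩

theorem exists_extend {v : Plane} (hS : IsPolygonalArc S p r) (hvr : v ≠ r) :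
    ∃ B ⊆ segment ℝ v p ∪ S, IsPolygonalArc B v r := by
  obtain ⟨z, ⟨hzv, hzS⟩, hclosest⟩ := ((isCompact_segment v p).inter hS.isCompact).exists_isMinOn
    ⟨p, right_mem_segment ℝ v p, hS.left_mem⟩ (f := fun u => dist v u) (by fun_prop)
  have hsub : segment ℝ v z ⊆ segment ℝ v p :=
    (convex_segment v p).segment_subset (left_mem_segment ℝ v p) hzv
  obtain rfl | hzr := eq_or_ne z r
  · exact ⟨_, hsub.trans subset_union_left, isPolygonalArc_segment hvr⟩
  obtain ⟨B, hBS, hB⟩ := hS.exists_truncate hzS hzr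
  obtain rfl | hvz := eq_or_ne v z
  · exact ⟨B, hBS.trans subset_union_right, hB⟩
  refine ⟨_, union_subset_union hsub hBS, hB.cons_segment hvz ?_⟩
  rintro u ⟨huv, huB⟩
  have hle : dist v z ≤ dist v u := hclosest ⟨hsub huv, hBS huB⟩
  have hadd := dist_add_dist_of_mem_segment huv
  exact dist_le_zero.mp (by linarith)

end IsPolygonalArc

theorem exists_isPolygonalArc_of_reflTransGen {F : Set Plane} {p r : Plane} (hpr : p ≠ r)
    (h : Relation.ReflTransGen (fun a b => segment ℝ a b ⊆ F) p r) :
    ∃ A ⊆ F, IsPolygonalArc A p r := by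
  induction h using Relation.ReflTransGen.head_induction_on with
  | refl => exact absurd rfl hpr
  | @head p q hpq _ ih =>
    obtain rfl | hqr := eq_or_ne q r
    · exact ⟨_, hpq, isPolygonalArc_segment hpr⟩
    · obtain ⟨B, hBF, hB⟩ := ih hqr
      obtain ⟨A, hA, hA'⟩ := hB.exists_extend hpr
      exact ⟨A, hA.trans (union_subset hpq hBF), hA'⟩

theorem exists_isPolygonalArc_of_mem_closure {C : Set Plane} {p q x : Plane} (hC : IsClosed C)
    (hpq : p ≠ q) (hCp : RadialAt C p) (hCq : RadialAt C q)
    (hp : p ∈ closure (connectedComponentIn Cᶜ x)) (hq : q ∈ closure (connectedComponentIn Cᶜ x)) :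
    ∃ A, IsPolygonalArc A p q ∧ A ∩ C ⊆ {p, q} := by
  obtain ⟨p', hp', hpp'⟩ := hCp.exists_segment_subset_insert hp
  obtain ⟨q', hq', hqq'⟩ := hCq.exists_segment_subset_insert hq
  set F := connectedComponentIn Cᶜ x
  have hp'q' : Relation.ReflTransGen (fun a b => segment ℝ a b ⊆ F ∪ {p, q}) p' q' :=
    Relation.ReflTransGen.mono (fun _ _ h => Subset.trans h subset_union_left) _ _
      (reflTransGen_segment_subset hC.isOpen_compl.connectedComponentIn
        isPreconnected_connectedComponentIn hp' hq')
  have hpp'' : segment ℝ p p' ⊆ F ∪ {p, q} :=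
    hpp'.trans (insert_subset (Or.inr (Or.inl rfl)) subset_union_left)
  have hq'q : segment ℝ q' q ⊆ F ∪ {p, q} := by
    rw [segment_symm]
    exact hqq'.trans (insert_subset (Or.inr (Or.inr rfl)) subset_union_left)
  obtain ⟨A, hAF, hA⟩ := exists_isPolygonalArc_of_reflTransGen hpq ((hp'q'.tail hq'q).head hpp'')
  exact ⟨A, hA, fun z hz =>
    (hAF hz.1).resolve_left fun hzF => connectedComponentIn_subset _ _ hzF hz.2⟩

/-! ### Drawings -/

theorem one_lt_rank_plane : 1 < Module.rank ℝ Plane := by simp [← Module.finrank_eq_rank]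

theorem mem_edgeSet_of_mem_edgeSet_sup_edge {V : Type*} {G : SimpleGraph V} {a b : V} {e : Sym2 V}
    (he : e ∈ (G ⊔ SimpleGraph.edge a b).edgeSet) (hne : e ≠ s(a, b)) : e ∈ G.edgeSet := by
  induction e with
  | _ u v =>
    refine he.resolve_right fun h => hne ?_
    rw [Sym2.eq_iff]
    exact ((SimpleGraph.edge_adj ..).mp h).1

namespace SimpleGraph.PlaneDrawing

variable {V : Type*} {G : SimpleGraph V} (D : G.PlaneDrawing)

theorem exists_isPolygonalArc {e : Sym2 V} (he : e ∈ G.edgeSet) :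
    ∃ p q, IsPolygonalArc (D.arc e) p q := by
  induction e with
  | _ u v => exact ⟨_, _, D.isPolygonalArc u v he⟩

theorem isClosed_arc {e : Sym2 V} (he : e ∈ G.edgeSet) : IsClosed (D.arc e) :=
  let ⟨_, _, h⟩ := D.exists_isPolygonalArc he
  h.isClosed

theorem arc_subset_carrier {e : Sym2 V} (he : e ∈ G.edgeSet) : D.arc e ⊆ D.carrier :=
  fun _ h => Or.inr (mem_biUnion he h)

theorem pos_mem_carrier (v : V) : D.pos v ∈ D.carrier := Or.inl (mem_range_self v)

theorem arc_inter_arc_subset_singleton {y a b : V} (ha : G.Adj y a) (hb : G.Adj y b)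
    (hab : a ≠ b) : D.arc s(y, a) ∩ D.arc s(y, b) ⊆ {D.pos y} := by
  refine (D.arc_inter_arc _ ha _ hb fun h => hab (Sym2.congr_right.mp h)).trans ?_
  rintro _ ⟨w, ⟨hwa, hwb⟩, rfl⟩
  rw [Sym2.mem_iff] at hwa hwb
  obtain rfl | rfl := hwa
  · rfl
  · rw [hwb.resolve_right hab, mem_singleton_iff]

/-- The drawing of a subgraph, obtained by erasing the other vertices and edges. -/
def comap {W : Type*} {H : SimpleGraph W} (f : Copy H G) : H.PlaneDrawing where
  pos := D.pos ∘ f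
  arc e := D.arc (e.map f)
  pos_injective := D.pos_injective.comp f.injective
  isPolygonalArc u v h := D.isPolygonalArc (f u) (f v) (f.toHom.map_adj h)
  vertex_on_arc e he w hw := by
    obtain ⟨w', hw', h⟩ := Sym2.mem_map.mp
      (D.vertex_on_arc _ (f.toHom.map_mem_edgeSet he) _ hw)
    rwa [← f.injective h]
  arc_inter_arc e he g hg hne p hp := by
    obtain ⟨_, ⟨hve, hvg⟩, rfl⟩ := D.arc_inter_arc _ (f.toHom.map_mem_edgeSet he) _
      (f.toHom.map_mem_edgeSet hg) (fun h => hne (Sym2.map.injective f.injective h)) hp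
    obtain ⟨w, hw, rfl⟩ := Sym2.mem_map.mp hve
    obtain ⟨w', hw', h⟩ := Sym2.mem_map.mp hvg
    exact ⟨w, ⟨hw, f.injective h ▸ hw'⟩, rfl⟩

theorem comap_carrier_subset {W : Type*} {H : SimpleGraph W} (f : Copy H G) :
    (D.comap f).carrier ⊆ D.carrier := by
  rintro p (⟨w, rfl⟩ | hp)
  · exact D.pos_mem_carrier (f w)
  · obtain ⟨e, he, hp⟩ := mem_iUnion₂.mp hp
    exact D.arc_subset_carrier (f.toHom.map_mem_edgeSet he) hp

section SupEdge

variable {D} {a b : V} {A : Set Plane}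

theorem inter_arc_subset_of_inter_carrier_subset (hAD : A ∩ D.carrier ⊆ {D.pos a, D.pos b})
    {e : Sym2 V} (he : e ∈ G.edgeSet) : A ∩ D.arc e ⊆ D.pos '' {w | w ∈ s(a, b) ∧ w ∈ e} := by
  rintro p ⟨hpA, hpe⟩
  rcases hAD ⟨hpA, D.arc_subset_carrier he hpe⟩ with rfl | rfl
  · exact ⟨a, ⟨Sym2.mem_mk_left a b, D.vertex_on_arc e he _ hpe⟩, rfl⟩
  · exact ⟨b, ⟨Sym2.mem_mk_right a b, D.vertex_on_arc e he _ hpe⟩, rfl⟩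

open Classical in
/-- The drawing with an additional edge between `a` and `b`, drawn along the arc `A`. -/
noncomputable def supEdge (hA : IsPolygonalArc A (D.pos a) (D.pos b))
    (hAD : A ∩ D.carrier ⊆ {D.pos a, D.pos b}) : (G ⊔ edge a b).PlaneDrawing where
  pos := D.pos
  arc e := if e = s(a, b) then A else D.arc e
  pos_injective := D.pos_injective
  isPolygonalArc u v huv := by
    split_ifs with h
    · rcases Sym2.eq_iff.mp h with ⟨rfl, rfl⟩ | ⟨rfl, rfl⟩
      exacts [hA, hA.symm]
    · exact D.isPolygonalArc u v (mem_edgeSet_of_mem_edgeSet_sup_edge huv h)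
  vertex_on_arc e he w hw := by
    split_ifs at hw with h
    · rw [h, Sym2.mem_iff]
      exact (hAD ⟨hw, D.pos_mem_carrier w⟩).imp (@D.pos_injective _ _) (@D.pos_injective _ _)
    · exact D.vertex_on_arc e (mem_edgeSet_of_mem_edgeSet_sup_edge he h) w hw
  arc_inter_arc e he f hf hne := by
    split_ifs with he' hf' hf'
    · exact absurd (he'.trans hf'.symm) hne
    · rw [he']
      exact inter_arc_subset_of_inter_carrier_subset hAD
        (mem_edgeSet_of_mem_edgeSet_sup_edge hf hf')
    · rw [hf', inter_comm]
      refine (inter_arc_subset_of_inter_carrier_subset hAD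
        (mem_edgeSet_of_mem_edgeSet_sup_edge he he')).trans (image_mono fun w hw => hw.symm)
    · exact D.arc_inter_arc e (mem_edgeSet_of_mem_edgeSet_sup_edge he he') f
        (mem_edgeSet_of_mem_edgeSet_sup_edge hf hf') hne

theorem supEdge_carrier_subset (hA : IsPolygonalArc A (D.pos a) (D.pos b))
    (hAD : A ∩ D.carrier ⊆ {D.pos a, D.pos b}) :
    (D.supEdge hA hAD).carrier ⊆ D.carrier ∪ A := by
  rintro p (hp | hp)
  · exact Or.inl (Or.inl hp)
  · obtain ⟨e, he, hp⟩ := mem_iUnion₂.mp hp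
    simp only [supEdge] at hp
    split_ifs at hp with h
    · exact Or.inr hp
    · exact Or.inl (D.arc_subset_carrier (mem_edgeSet_of_mem_edgeSet_sup_edge he h) hp)

end SupEdge

theorem mem_frontier_outerFace {v : V} {T : Set Plane} (hTD : T ⊆ D.carrierᶜ)
    (hT : IsPreconnected T) (hTu : ¬ Bornology.IsBounded T) (hv : D.pos v ∈ closure T) :
    D.pos v ∈ frontier D.outerFace := by
  refine ⟨closure_mono (fun t ht => ?_) hv,
    fun h => (interior_subset h).1 (D.pos_mem_carrier v)⟩
  exact ⟨hTD ht, fun hb => hTu (hb.subset (hT.subset_connectedComponentIn ht hTD))⟩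

theorem outerFace_subset_connectedComponentIn {r : ℝ} {w : Plane}
    (hr : D.carrier ⊆ Metric.ball 0 r) (hw : w ∉ Metric.ball 0 r) :
    D.outerFace ⊆ connectedComponentIn D.carrierᶜ w := by
  rintro x ⟨hx, hunbounded⟩
  obtain ⟨w', hw'x, hw'⟩ := not_subset.mp fun h => hunbounded (Metric.isBounded_ball.subset h)
  have hww' := (isPreconnected_compl_ball one_lt_rank_plane 0 r).subset_connectedComponentIn hw
    (compl_subset_compl.mpr hr) hw'
  rw [connectedComponentIn_eq hww', ← connectedComponentIn_eq hw'x]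
  exact mem_connectedComponentIn hx

theorem exists_eventuallyEq_spokes_at_vertex (y : V) : ∃ θ : V → Real.Angle,
    InjOn θ (G.neighborSet y) ∧
    ∀ a ∈ G.neighborSet y, D.arc s(y, a) =ᶠ[𝓝 (D.pos y)] spokes (D.pos y) {θ a} := by
  choose! θ hθ using fun a (ha : G.Adj y a) => (D.isPolygonalArc y a ha).exists_eventuallyEq_spokes
  refine ⟨θ, fun a ha b hb hab => ?_, hθ⟩
  by_contra hne
  have hinter : (spokes (D.pos y) {θ a} ∩ spokes (D.pos y) {θ b} : Set Plane) ≤ᶠ[𝓝 (D.pos y)]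
      ({D.pos y} : Set Plane) :=
    ((hθ a ha).inter (hθ b hb)).symm.le.trans
      (D.arc_inter_arc_subset_singleton ha hb hne).eventuallyLE
  exact disjoint_singleton.mp (disjoint_of_spokes_inter_spokes_eventuallyLE hinter) hab

section Finite

variable [Finite V]

theorem isCompact_carrier : IsCompact D.carrier := by
  refine (finite_range D.pos).isCompact.union (G.edgeSet.toFinite.isCompact_biUnion fun e he => ?_)
  obtain ⟨p, q, h⟩ := D.exists_isPolygonalArc he
  exact h.isCompact

theorem radialAt_carrier (p : Plane) : RadialAt D.carrier p := by
  refine RadialAt.union ?_ (RadialAt.biUnion G.edgeSet.toFinite fun e he => ?_)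
  · rw [← biUnion_of_singleton (range D.pos)]
    refine RadialAt.biUnion (finite_range D.pos) fun v _ => ?_
    rw [← segment_same ℝ]
    exact RadialAt.segment _ _ _
  · obtain ⟨_, _, h⟩ := D.exists_isPolygonalArc he
    exact h.radialAt p

theorem carrier_eventuallyEq_biUnion_arc {e : Sym2 V} {p : Plane} (he : e ∈ G.edgeSet)
    (hp : p ∈ D.arc e) :
    D.carrier =ᶠ[𝓝 p] ⋃ f ∈ {f ∈ G.edgeSet | p ∈ D.arc f}, D.arc f := by
  have hsplit : D.carrier = (⋃ f ∈ G.edgeSet, D.arc f) ∪ (range D.pos \ {p}) := by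
    have hpU : {p} ⊆ ⋃ f ∈ G.edgeSet, D.arc f := singleton_subset_iff.mpr (mem_biUnion he hp)
    rw [carrier, union_comm, ← union_eq_left.mpr hpU, union_assoc, union_assoc,
      union_sdiff_self]
  rw [hsplit]
  exact (union_eventuallyEq_left_of_notMem (toFinite _).isClosed fun h => h.2 rfl).trans
    (biUnion_eventuallyEq_biUnion_mem G.edgeSet.toFinite (fun _ => D.isClosed_arc) p)

theorem carrier_eventuallyEq_arc {u v : V} {p : Plane} (huv : G.Adj u v)
    (hp : p ∈ D.arc s(u, v) \ {D.pos u, D.pos v}) : D.carrier =ᶠ[𝓝 p] D.arc s(u, v) := by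
  have hedges : {f ∈ G.edgeSet | p ∈ D.arc f} = {s(u, v)} := by
    refine Subset.antisymm (fun f hf => ?_) (singleton_subset_iff.mpr ⟨huv, hp.1⟩)
    by_contra hne
    obtain ⟨w, ⟨-, hw⟩, rfl⟩ := D.arc_inter_arc f hf.1 _ huv hne ⟨hf.2, hp.1⟩
    exact hp.2 ((Sym2.mem_iff.mp hw).imp (congrArg D.pos) (congrArg D.pos))
  have h := D.carrier_eventuallyEq_biUnion_arc huv hp.1
  rwa [hedges, biUnion_singleton] at h

theorem carrier_eventuallyLE_spokes {y a : V} (ha : G.Adj y a) {θ : V → Real.Angle}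
    (hθ : ∀ a ∈ G.neighborSet y, D.arc s(y, a) =ᶠ[𝓝 (D.pos y)] spokes (D.pos y) {θ a}) :
    D.carrier ≤ᶠ[𝓝 (D.pos y)] spokes (D.pos y) (θ '' G.neighborSet y) := by
  filter_upwards [(D.carrier_eventuallyEq_biUnion_arc ha (D.isPolygonalArc y a ha).left_mem).le,
    (eventually_all_finite (G.neighborSet y).toFinite).mpr fun a ha => (hθ a ha).le]
    with q hq hqθ hqD
  obtain ⟨f, ⟨hf, hyf⟩, hqf⟩ := mem_iUnion₂.mp (hq hqD)
  obtain ⟨x, rfl⟩ := Sym2.mem_iff_exists.mp (D.vertex_on_arc f hf y hyf)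
  exact image2_subset_left (singleton_subset_iff.mpr (mem_image_of_mem θ hf)) (hqθ x hf hqf)

theorem exists_common_face {K : Set Plane} (hK : IsClosed K) (hKD : K ∩ D.carrier ⊆ range D.pos)
    {y a b : V} (hy : D.pos y ∉ K) (hdeg : (G.neighborSet y).encard ≤ 3) (ha : G.Adj y a)
    (hb : G.Adj y b) (hab : a ≠ b) :
    ∃ x, D.pos a ∈ closure (connectedComponentIn (D.carrier ∪ K)ᶜ x) ∧
      D.pos b ∈ closure (connectedComponentIn (D.carrier ∪ K)ᶜ x) := by
  obtain ⟨θ, hinj, hθ⟩ := D.exists_eventuallyEq_spokes_at_vertex y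
  obtain ⟨x, hx⟩ := exists_spokes_pair_eventuallyLE_closure ((encard_image_le θ _).trans hdeg)
    (mem_image_of_mem θ ha) (mem_image_of_mem θ hb) (hinj.ne ha hb hab)
    ((union_eventuallyEq_left_of_notMem hK hy).le.trans (D.carrier_eventuallyLE_spokes ha hθ))
  have reaches {c : V} (hc : G.Adj y c) (hθc : θ c ∈ ({θ a, θ b} : Set Real.Angle)) :
      D.pos c ∈ closure (connectedComponentIn (D.carrier ∪ K)ᶜ x) := by
    have hA := D.isPolygonalArc y c hc
    have hAx := (hθ c hc).le.trans
      ((image2_subset_left (singleton_subset_iff.mpr hθc)).eventuallyLE.trans hx)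
    refine hA.subset_closure_connectedComponentIn (fun p hp => ?_) ?_ hA.right_mem
    · refine (union_eventuallyEq_left_of_notMem hK fun hpK => ?_).trans
        (D.carrier_eventuallyEq_arc hc hp)
      obtain ⟨w, rfl⟩ := hKD ⟨hpK, D.arc_subset_carrier hc hp.1⟩
      exact hp.2 ((Sym2.mem_iff.mp (D.vertex_on_arc _ hc w hp.1)).imp
        (congrArg D.pos) (congrArg D.pos))
    · obtain ⟨p, hpx, hp⟩ := mem_closure_iff_nhds.mp (hA.subset_closure_sdiff hA.left_mem) _ hAx
      exact ⟨p, hp, hpx hp.1⟩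
  exact ⟨x, reaches ha (Or.inl rfl), reaches hb (Or.inr rfl)⟩

section Barrier

variable {D} {X : Set V} {K : Set Plane} (hK : IsClosed K) (hKD : K ∩ D.carrier ⊆ D.pos '' X)
  (hKX : ∀ x ∈ X, RadialAt K (D.pos x))
include hK hKD hKX

theorem exists_sup_edge_planeDrawing {y u v : V} (hu : u ∈ X) (hv : v ∈ X) (hne : u ≠ v)
    (hy : y ∈ G.commonNeighbors u v \ X) (hdeg : (G.neighborSet y).encard ≤ 3) :
    ∃ D' : (G ⊔ edge u v).PlaneDrawing, D'.pos = D.pos ∧ K ∩ D'.carrier ⊆ D.pos '' X := by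
  have hyK : D.pos y ∉ K := fun h =>
    hy.2 ((D.pos_injective.mem_set_image).mp (hKD ⟨h, D.pos_mem_carrier y⟩))
  obtain ⟨x, hux, hvx⟩ := D.exists_common_face hK (hKD.trans (image_subset_range _ _)) hyK hdeg
    hy.1.1.symm hy.1.2.symm hne
  obtain ⟨A, hA, hAD⟩ := exists_isPolygonalArc_of_mem_closure
    (D.isCompact_carrier.isClosed.union hK) (D.pos_injective.ne hne)
    ((D.radialAt_carrier _).union (hKX u hu)) ((D.radialAt_carrier _).union (hKX v hv)) hux hvx
  rw [inter_union_distrib_left, union_subset_iff] at hAD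
  refine ⟨D.supEdge hA hAD.1, rfl, fun p hp => ?_⟩
  rcases supEdge_carrier_subset hA hAD.1 hp.2 with hpD | hpA
  · exact hKD ⟨hp.1, hpD⟩
  · rcases hAD.2 ⟨hpA, hp.1⟩ with rfl | rfl
    exacts [mem_image_of_mem _ hu, mem_image_of_mem _ hv]

theorem exists_supergraph_planeDrawing (hdeg : ∀ y ∉ X, (G.neighborSet y).encard ≤ 3) :
    ∃ (H : SimpleGraph V) (D' : H.PlaneDrawing), D'.pos = D.pos ∧ K ∩ D'.carrier ⊆ D.pos '' X ∧
      ∀ u ∈ X, ∀ v ∈ X, u ≠ v → (G.commonNeighbors u v \ X).Nonempty → H.Adj u v := by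
  obtain ⟨H, ⟨hGH, hHG, D', hpos, hKD'⟩, hmax⟩ := (toFinite {H : SimpleGraph V | G ≤ H ∧
    (∀ y ∉ X, H.neighborSet y ⊆ G.neighborSet y) ∧ ∃ D' : H.PlaneDrawing, D'.pos = D.pos ∧
      K ∩ D'.carrier ⊆ D.pos '' X}).exists_maximal
    ⟨G, le_rfl, fun _ _ => Subset.rfl, D, rfl, hKD⟩
  refine ⟨H, D', hpos, hKD', fun u hu v hv hne ⟨y, hy⟩ => ?_⟩
  rw [← hpos] at hKD' hKX
  obtain ⟨D'', hpos', hKD''⟩ := exists_sup_edge_planeDrawing hK hKD' hKX hu hv hne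
    ⟨⟨hGH hy.1.1, hGH hy.1.2⟩, hy.2⟩ ((encard_le_encard (hHG y hy.2)).trans (hdeg y hy.2))
  rw [hpos] at hpos' hKD''
  refine hmax ⟨hGH.trans le_sup_left, fun z hz w hw => ?_, D'', hpos', hKD''⟩ le_sup_left
    (Or.inr ((edge_adj ..).mpr ⟨Or.inl ⟨rfl, rfl⟩, hne⟩))
  refine hHG z hz (hw.resolve_right fun hzw => hz ?_)
  obtain ⟨⟨rfl, -⟩ | ⟨rfl, -⟩, -⟩ := (edge_adj ..).mp hzw
  exacts [hu, hv]

theorem exists_planeDrawing_of_commonNeighbors (hdeg : ∀ y ∉ X, (G.neighborSet y).encard ≤ 3)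
    {F : SimpleGraph X} (hF : ∀ u v, F.Adj u v → (G.commonNeighbors (u : V) v \ X).Nonempty) :
    ∃ D' : F.PlaneDrawing, (∀ x, D'.pos x = D.pos x) ∧ K ∩ D'.carrier ⊆ D.pos '' X := by
  obtain ⟨H, D', hpos, hKD', hH⟩ := exists_supergraph_planeDrawing hK hKD hKX hdeg
  let f : Copy F H := ⟨⟨Subtype.val, fun {u v} huv =>
    hH u u.2 v v.2 (Subtype.val_injective.ne huv.ne) (hF u v huv)⟩, Subtype.val_injective⟩
  exact ⟨D'.comap f, fun x => congrFun hpos x,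
    (inter_subset_inter_right K (D'.comap_carrier_subset f)).trans hKD'⟩

end Barrier

theorem exists_isPolygonalArc_of_mem_frontier_outerFace {r : ℝ} {v : V} {w : Plane}
    (hr : D.carrier ⊆ Metric.ball 0 r) (hw : w ∉ Metric.ball 0 r)
    (hv : D.pos v ∈ frontier D.outerFace) :
    ∃ A, IsPolygonalArc A (D.pos v) w ∧ A ∩ D.carrier ⊆ {D.pos v} := by
  have hwD : w ∉ D.carrier := fun h => hw (hr h)
  have hclosed := D.isCompact_carrier.isClosed
  obtain ⟨A, hA, hAD⟩ := exists_isPolygonalArc_of_mem_closure hclosed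
    (fun h : D.pos v = w => hwD (h ▸ D.pos_mem_carrier v)) (D.radialAt_carrier _)
    (RadialAt.of_notMem hclosed hwD)
    (closure_mono (D.outerFace_subset_connectedComponentIn hr hw) (frontier_subset_closure hv))
    (subset_closure (mem_connectedComponentIn hwD))
  exact ⟨A, hA, fun p hp => (hAD hp).resolve_right fun h => hwD (h ▸ hp.2)⟩

/-- The barrier `K` consists of the outside of a large disc and of arcs that join it to the
vertices in `X`; a drawing that avoids `K` keeps these vertices on the boundary of its outer
face. -/
theorem exists_barrier {X : Set V} (hX : ∀ x ∈ X, D.pos x ∈ frontier D.outerFace) :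
    ∃ K : Set Plane, IsClosed K ∧ K ∩ D.carrier ⊆ D.pos '' X ∧
      (∀ x ∈ X, RadialAt K (D.pos x)) ∧ ∀ x ∈ X, ∃ T ⊆ K \ D.carrier, IsPreconnected T ∧
        ¬ Bornology.IsBounded T ∧ D.pos x ∈ closure T := by
  obtain ⟨r, hr⟩ := D.isCompact_carrier.isBounded.subset_ball 0
  set W : Set Plane := (Metric.ball 0 r)ᶜ
  have hWc : IsClosed W := Metric.isOpen_ball.isClosed_compl
  have hWD : W ⊆ D.carrierᶜ := compl_subset_compl.mpr hr
  have hWu : ¬ Bornology.IsBounded W := fun h => NormedSpace.unbounded_univ ℝ Plane <| by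
    rw [← union_compl_self (Metric.ball 0 r)]
    exact Metric.isBounded_ball.union h
  obtain ⟨w, hw⟩ : W.Nonempty :=
    nonempty_iff_ne_empty.mpr fun h => hWu (h ▸ Bornology.isBounded_empty)
  have hescape (x) (hx : x ∈ X) := D.exists_isPolygonalArc_of_mem_frontier_outerFace hr hw (hX x hx)
  choose! A hA hAD using hescape
  refine ⟨W ∪ ⋃ x ∈ X, A x, hWc.union (X.toFinite.isClosed_biUnion fun x hx => (hA x hx).isClosed),
    ?_, fun x _ => ?_, fun x hx => ⟨A x \ {D.pos x} ∪ W, ?_, ?_, ?_, ?_⟩⟩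
  · rintro p ⟨hp | hp, hpD⟩
    · exact absurd hpD (hWD hp)
    · obtain ⟨x, hx, hp⟩ := mem_iUnion₂.mp hp
      exact ⟨x, hx, (hAD x hx ⟨hp, hpD⟩).symm⟩
  · exact (RadialAt.of_notMem hWc fun h => hWD h (D.pos_mem_carrier x)).union
      (RadialAt.biUnion X.toFinite fun x' hx' => (hA x' hx').radialAt _)
  · rintro p (⟨hp, hpx⟩ | hp)
    · exact ⟨Or.inr (mem_biUnion hx hp), fun hpD => hpx (hAD x hx ⟨hp, hpD⟩)⟩
    · exact ⟨Or.inl hp, hWD hp⟩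
  · have hwx : w ≠ D.pos x := fun h => hWD hw (h ▸ D.pos_mem_carrier x)
    exact ((hA x hx).isPreconnected_sdiff fun p hp => Or.inl hp.2).union w
      ⟨(hA x hx).right_mem, hwx⟩ hw (isPreconnected_compl_ball one_lt_rank_plane 0 r)
  · exact fun h => hWu (h.subset subset_union_right)
  · refine closure_mono ?_ ((hA x hx).subset_closure_sdiff (hA x hx).left_mem)
    exact fun p hp => Or.inl ⟨hp.1, fun h => hp.2 (Or.inl h)⟩

end Finite

end SimpleGraph.PlaneDrawing

/-! ### The exact square -/

theorem SimpleGraph.IsPlanar.of_commonNeighbors {V : Type*} [Finite V] {G : SimpleGraph V}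
    {X : Set V} (hG : G.IsPlanar) (hdeg : ∀ y ∉ X, (G.neighborSet y).encard ≤ 3)
    {F : SimpleGraph X}
    (hF : ∀ u v, F.Adj u v → (G.commonNeighbors (u : V) v \ X).Nonempty) : F.IsPlanar := by
  obtain ⟨D⟩ := hG
  obtain ⟨D', -⟩ := PlaneDrawing.exists_planeDrawing_of_commonNeighbors (D := D) isClosed_empty
    ((empty_inter _).trans_subset (empty_subset _))
    (fun x _ => RadialAt.of_notMem isClosed_empty (notMem_empty (D.pos x))) hdeg hF
  exact ⟨D'⟩

theorem SimpleGraph.IsOuterplanar.of_commonNeighbors {V : Type*} [Finite V] {G : SimpleGraph V}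
    {X : Set V} (hG : G.IsOuterplanar) (hdeg : ∀ y ∉ X, (G.neighborSet y).encard ≤ 3)
    {F : SimpleGraph X}
    (hF : ∀ u v, F.Adj u v → (G.commonNeighbors (u : V) v \ X).Nonempty) : F.IsOuterplanar := by
  obtain ⟨D, hD⟩ := hG
  obtain ⟨K, hK, hKD, hKX, hT⟩ := D.exists_barrier (X := X) fun x _ => hD x
  obtain ⟨D', hpos, hKD'⟩ :=
    PlaneDrawing.exists_planeDrawing_of_commonNeighbors hK hKD hKX hdeg hF
  refine ⟨D', fun x => ?_⟩
  obtain ⟨T, hTK, hTp, hTu, hxT⟩ := hT x x.2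
  refine D'.mem_frontier_outerFace (fun p hp hpD' => ?_) hTp hTu (hpos x ▸ hxT)
  obtain ⟨z, -, rfl⟩ := hKD' ⟨(hTK hp).1, hpD'⟩
  exact (hTK hp).2 (D.pos_mem_carrier z)

namespace SimpleGraph.exactSquare

variable {V : Type*} {G : SimpleGraph V} {X Y : Set V} {u v : V}

theorem adj_iff :
    G.exactSquare.Adj u v ↔ u ≠ v ∧ ¬ G.Adj u v ∧ (G.commonNeighbors u v).Nonempty := by
  rw [← edist_eq_two_iff]
  exact ENat.toNat_eq_iff two_ne_zero

theorem adj_iff_of_isBipartiteWith (hXY : G.IsBipartiteWith X Y) (hu : u ∈ X) :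
    G.exactSquare.Adj u v ↔ u ≠ v ∧ (G.commonNeighbors u v).Nonempty := by
  rw [adj_iff]
  refine and_congr_right fun _ => and_iff_right_of_imp fun ⟨y, huy, hvy⟩ huv => ?_
  have hv : v ∈ X := hXY.symm.mem_of_mem_adj (hXY.mem_of_mem_adj hu huy) hvy.symm
  exact hXY.disjoint.notMem_of_mem_left hv (hXY.mem_of_mem_adj hu huv)

theorem mem_of_reachable (hXY : G.IsBipartiteWith X Y) (h : G.exactSquare.Reachable u v)
    (hu : u ∈ X) : v ∈ X := by
  obtain ⟨p⟩ := h
  induction p with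
  | nil => exact hu
  | cons huv _ ih =>
    obtain ⟨-, y, huy, hvy⟩ := (adj_iff_of_isBipartiteWith hXY hu).mp huv
    exact ih (hXY.symm.mem_of_mem_adj (hXY.mem_of_mem_adj hu huy) hvy.symm)

theorem reachable_of_walk (hXY : G.IsBipartiteWith X Y) {u v : V} (hu : u ∈ X) (hv : v ∈ X) :
    G.Walk u v → G.exactSquare.Reachable u v
  | .nil => .rfl
  | .cons h .nil => (hXY.disjoint.notMem_of_mem_left hv (hXY.mem_of_mem_adj hu h)).elim
  | .cons (v := y) h (.cons (v := w) h' p) => by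
    have hw : w ∈ X := hXY.symm.mem_of_mem_adj (hXY.mem_of_mem_adj hu h) h'
    have huw : G.exactSquare.Reachable u w := by
      rcases eq_or_ne u w with rfl | hne
      · exact .rfl
      · exact ((adj_iff_of_isBipartiteWith hXY hu).mpr ⟨hne, y, h, h'.symm⟩).reachable
    exact huw.trans (reachable_of_walk hXY hw hv p)

theorem supp_connectedComponentMk (hG : G.Preconnected) (hXY : G.IsBipartiteWith X Y)
    (hu : u ∈ X) : (G.exactSquare.connectedComponentMk u).supp = X := by
  ext v
  rw [ConnectedComponent.mem_supp_iff, ConnectedComponent.eq]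
  refine ⟨fun h => mem_of_reachable hXY h.symm hu, fun hv => ?_⟩
  obtain ⟨p⟩ := hG v u
  exact reachable_of_walk hXY hv hu p

theorem commonNeighbors_sdiff_nonempty (hXY : G.IsBipartiteWith X Y) (hu : u ∈ X)
    (h : G.exactSquare.Adj u v) : (G.commonNeighbors u v \ X).Nonempty := by
  obtain ⟨-, y, huy, hvy⟩ := (adj_iff_of_isBipartiteWith hXY hu).mp h
  exact ⟨y, ⟨huy, hvy⟩, hXY.disjoint.notMem_of_mem_right (hXY.mem_of_mem_adj hu huy)⟩

theorem exists_supp_eq [Nontrivial V] (hG : G.Connected) (hXY : G.IsBipartiteWith X Y) :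
    ∃ c : G.exactSquare.ConnectedComponent, c.supp = X := by
  obtain ⟨v⟩ := hG.nonempty
  obtain ⟨w, hvw⟩ := hG.preconnected.exists_adj_of_nontrivial v
  obtain ⟨x, hx⟩ : ∃ x, x ∈ X :=
    (hXY.mem_of_adj hvw).elim (fun h => ⟨v, h.1⟩) fun h => ⟨w, h.2⟩
  exact ⟨_, supp_connectedComponentMk hG.preconnected hXY hx⟩

variable [Finite V] {c : G.exactSquare.ConnectedComponent}

theorem isPlanar_toSimpleGraph (hG : G.IsPlanar) (hXY : G.IsBipartiteWith X Y)
    (hdeg : ∀ y ∉ X, (G.neighborSet y).encard ≤ 3) (hc : c.supp = X) :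
    c.toSimpleGraph.IsPlanar := by
  subst hc
  exact hG.of_commonNeighbors hdeg fun u _ huv => commonNeighbors_sdiff_nonempty hXY u.2 huv

theorem isOuterplanar_toSimpleGraph (hG : G.IsOuterplanar) (hXY : G.IsBipartiteWith X Y)
    (hdeg : ∀ y ∉ X, (G.neighborSet y).encard ≤ 3) (hc : c.supp = X) :
    c.toSimpleGraph.IsOuterplanar := by
  subst hc
  exact hG.of_commonNeighbors hdeg fun u _ huv => commonNeighbors_sdiff_nonempty hXY u.2 huv

end SimpleGraph.exactSquare

theorem mainTheorem5 {V : Type*} [Finite V] [Nontrivial V] (G : SimpleGraph V)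
    (hconn : G.Connected) (hplanar : G.IsPlanar) (hsub : G.IsSubcubic)
    (X Y : Set V) (hXY : G.IsBipartiteWith X Y) :
    ∃ cX cY : G.exactSquare.ConnectedComponent,
      cX ≠ cY ∧ (∀ c : G.exactSquare.ConnectedComponent, c = cX ∨ c = cY) ∧
      cX.supp = X ∧ cY.supp = Y ∧
      cX.toSimpleGraph.IsPlanar ∧ cY.toSimpleGraph.IsPlanar ∧
      (G.IsOuterplanar → cX.toSimpleGraph.IsOuterplanar ∧ cY.toSimpleGraph.IsOuterplanar) := by
  have hdeg (Z : Set V) : ∀ y ∉ Z, (G.neighborSet y).encard ≤ 3 := fun y _ => hsub y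
  obtain ⟨cX, hX⟩ := SimpleGraph.exactSquare.exists_supp_eq hconn hXY
  obtain ⟨cY, hY⟩ := SimpleGraph.exactSquare.exists_supp_eq hconn hXY.symm
  refine ⟨cX, cY, ?_, fun c => ?_, hX, hY,
    SimpleGraph.exactSquare.isPlanar_toSimpleGraph hplanar hXY (hdeg X) hX,
    SimpleGraph.exactSquare.isPlanar_toSimpleGraph hplanar hXY.symm (hdeg Y) hY,
    fun houter => ⟨SimpleGraph.exactSquare.isOuterplanar_toSimpleGraph houter hXY (hdeg X) hX,
      SimpleGraph.exactSquare.isOuterplanar_toSimpleGraph houter hXY.symm (hdeg Y) hY⟩⟩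
  · rintro rfl
    obtain ⟨v, hv⟩ := cX.nonempty_supp
    exact hXY.disjoint.notMem_of_mem_left (hX.subset hv) (hY.subset hv)
  · obtain ⟨v, rfl⟩ := c.exists_rep
    obtain ⟨w, hvw⟩ := hconn.preconnected.exists_adj_of_nontrivial v
    exact (hXY.mem_of_adj hvw).imp (fun h => hX.symm.subset h.1) fun h => hY.symm.subset h.1
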